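/- Throughout, an algebra over a field $k$ is a commutative, associative, not necessarily unital $k$-algebra. For $r\ge 1$ let $\Omega_r$ be the category whose objects are the sets $\langle p\rangle=\{1,\dots,p\}$, $1\le p\le r$, and whose morphisms are the surjective maps. An algebra $A$ gives a functor $L^r(A)\colon\Omega_r\to k\text{-}\mathbf{Mod}$, $\langle p\rangle\mapsto A^{\otimes p}$, which sends a surjection $s\colon\langle p\rangle\to\langle q\rangle$ to the linear map $a_1\otimes\dots\otimes a_p\mapsto m_1\otimes\dots\otimes m_q$, $m_j=\prod_{i\in s^{-1}(j)}a_i$. An algebra homomorphism $f$ induces the natural transformation $L^r(f)$ with components $f^{\otimes p}$. A graph $G=(G_1,G_2)$ is a set $G_1$ with a reflexive symmetric relation $G_2\subseteq G_1\times G_1$; a morphism of graphs is a map of vertices preserving the relations. The algebra $Q(G)$ is $k^{G_1}\oplus(k^{G_2})_{\Sigma_2}$ (coinvariants of the swap of coordinates), where the product of $a,b\in k^{G_1}$ is the class of the function $(x,y)\mapsto a(x)b(y)$ on $G_2$, and all products involving an element of $(k^{G_2})_{\Sigma_2}$ are $0$. A graph morphism $f\colon G\to H$ induces by composition an algebra homomorphism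 $Q(f)\colon Q(H)\to Q(G)$. Let $n\ge 1$. The graph $B_n$ has the vertices $x_j^v$, where $1\le j\le 2n+1$ and $v\in\{1,-1\}$ if $j$ is odd, $v\in\{1,-1,0\}$ if $j$ is even; its edges join $x_j^u$ with $x_{j+1}^v$ whenever $uv\in\{1,0\}$. For $n\ge2$ and $s=\pm1$, the crown $C_n^s$ is obtained from $B_n$ by identifying $x_{2n+1}^v$ with $x_1^{sv}$ for $v=\pm1$ (the simple crown for $s=1$, the Möbius crown for $s=-1$). Let $W_n$ be the commutative monoid (under the coordinatewise product) of all $w\in\{1,-1,0\}^{2n+1}$ with $w_j\ne0$ for odd $j$ and $w_jw_{j+1}\in\{1,0\}$ for $1\le j\le 2n$. It acts on $B_n$ by $w\cdot x_j^v=x_j^{w_jv}$. For $s,t\in\{1,-1\}$ put $W_n(s,t)=\{w\in W_n: w_1w_{2n+1}s=t\}$; each $w\in W_n(s,t)$ induces a graph morphism $w_*\colon C_n^s\to C_n^t$. Let $b_n^r(X)\colon L^r(Q(B_n))\to L^r(Q(B_n))$ for $X\in k[W_n]$, and $c_n^r(X|_{s\to t})\colon L^r(Q(C_n^t))\to L^r(Q(C_n^s))$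 for $X\in k[W_n(s,t)]$, be the linear extensions of $w\mapsto L^r(Q(w_*))$. For $1\le i\le n$ let $g_i\in W_n$ have the entry $0$ in position $2i$ and all other entries $1$, let $h_i\in W_n$ have the entries $-1$ in positions less than $2i$, $0$ in position $2i$, and $1$ in positions greater than $2i$, and put in $k[W_n]$ $$T_n=\sum_{i=1}^n(1-[g_1])\cdots(1-[g_{i-1}])[h_i],\qquad Z_n=(1-[g_1])\cdots(1-[g_n]).$$ One has $T_n\in k[W_n(s,-s)]$ and $Z_n\in k[W_n(s,s)]$ for $s=\pm1$. **Theorem.** Let $k$ be any field, let $r\ge1$ and $n=r+1$. Then the algebras $A=Q(C_n^{+})$ and $B=Q(C_n^{-})$ are finite-dimensional over $k$ and are not isomorphic as $k$-algebras, but the representations $L^r(A)$ and $L^r(B)$ of $\Omega_r$ are isomorphic. More precisely, $T_n^2=1-Z_n$ in $k[W_n]$; $b_n^r(Z_n)=0$ and $c_n^r(Z_n|_{s\to s})=0$ for $s=\pm1$; and the morphisms $$c_n^r(T_n|_{-\to+})\colon L^r(A)\to L^r(B),\qquad c_n^r(T_n|_{+\to-})\colon L^r(B)\to L^r(A)$$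 are mutually inverse isomorphisms. -/

import Mathlib

open CategoryTheory
open scoped TensorProduct

noncomputable section

namespace MobiusCrown

universe u

/-! ## The category `Ω_r` -/

/-- The objects of `Ω_r`: the finite sets `⟨p⟩` with `1 ≤ p ≤ r`. The set `⟨p⟩` is modelled by
`Fin p`. -/
structure Omega (r : ℕ) where
  /-- the cardinality `p` of `⟨p⟩` -/
  card : ℕ
  one_le : 1 ≤ card
  le : card ≤ r

/-- The morphisms `⟨p⟩ → ⟨q⟩` of `Ω_r` are the surjective maps. -/
instance (r : ℕ) : Category (Omega r) where
  Hom p q := {s : Fin p.card → Fin q.card // Function.Surjective s}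
  id _ := ⟨id, Function.surjective_id⟩
  comp s t := ⟨t.1 ∘ s.1, t.2.comp s.2⟩

/-! ## The representation `L^r(A)` of `Ω_r` -/

section Loday

variable (k : Type u) [Field k]
variable {A : Type u} [NonUnitalCommRing A] [Module k A] [IsScalarTower k A A] [SMulCommClass k A A]

/-- The product `∏_{i ∈ F} a i` of a family of elements of a non-unital commutative algebra
over a (nonempty) finite set `F`, computed in the unitization `k ⊕ A`.
See `inr_prodNE` and `prodNE_insert`. -/
def prodNE {ι : Type} (F : Finset ι) (a : ι → A) : A :=
  (∏ i ∈ F, (Unitization.inr (a i) : Unitization k A)).snd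

theorem inr_prodNE {ι : Type} (F : Finset ι) (hF : F.Nonempty) (a : ι → A) :
    (Unitization.inr (prodNE k F a) : Unitization k A) = ∏ i ∈ F, Unitization.inr (a i) := by
  refine Unitization.ext ?_ rfl
  obtain ⟨i, hi⟩ := hF
  have h : (∏ i ∈ F, (Unitization.inr (a i) : Unitization k A)).fst
      = ∏ i ∈ F, (Unitization.inr (a i) : Unitization k A).fst :=
    map_prod (Unitization.fstHom k A) _ _
  rw [h, Unitization.fst_inr, Finset.prod_eq_zero hi (Unitization.fst_inr k (a i))]

theorem prodNE_singleton {ι : Type} (i : ι) (a : ι → A) : prodNE k {i} a = a i := by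
  simp [prodNE]

theorem prodNE_insert {ι : Type} [DecidableEq ι] (F : Finset ι) (hF : F.Nonempty) (i : ι)
    (hi : i ∉ F) (a : ι → A) : prodNE k (insert i F) a = a i * prodNE k F a := by
  apply Unitization.inr_injective (R := k)
  rw [inr_prodNE k _ (Finset.insert_nonempty _ _), Finset.prod_insert hi, Unitization.inr_mul,
    inr_prodNE k _ hF]

theorem prodNE_congr {ι : Type} (F : Finset ι) (a b : ι → A) (h : ∀ i ∈ F, a i = b i) :
    prodNE k F a = prodNE k F b := by
  unfold prodNE
  have key : ∏ i ∈ F, (Unitization.inr (a i) : Unitization k A) = ∏ i ∈ F, Unitization.inr (b i) :=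
    Finset.prod_congr rfl fun i hi => by rw [h i hi]
  rw [key]

theorem prodNE_update {ι : Type} [DecidableEq ι] (F : Finset ι) (i : ι) (hi : i ∈ F)
    (a : ι → A) (x : A) : prodNE k F (Function.update a i x) =
      ((Unitization.inr x : Unitization k A) * ∏ j ∈ F.erase i, Unitization.inr (a j)).snd := by
  unfold prodNE
  rw [← Finset.mul_prod_erase F _ hi, Function.update_self]
  have key : ∏ j ∈ F.erase i, (Unitization.inr (Function.update a i x j) : Unitization k A) =
      ∏ j ∈ F.erase i, Unitization.inr (a j) :=
    Finset.prod_congr rfl fun j hj => by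
      rw [Function.update_of_ne (Finset.ne_of_mem_erase hj)]
  rw [key]

/-- `m_j = ∏_{i ∈ s⁻¹(j)} a_i`. -/
def fiberProd {p q : ℕ} (s : Fin p → Fin q) (a : Fin p → A) (j : Fin q) : A :=
  prodNE k (Finset.univ.filter fun i => s i = j) a

theorem fiberProd_update {p q : ℕ} (s : Fin p → Fin q) (a : Fin p → A) (i : Fin p) (x : A) :
    fiberProd k s (Function.update a i x) = Function.update (fiberProd k s a) (s i)
      (((Unitization.inr x : Unitization k A) *
        ∏ j ∈ (Finset.univ.filter fun i' => s i' = s i).erase i, Unitization.inr (a j)).snd) := by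
  funext j
  by_cases hj : j = s i
  · subst hj
    rw [Function.update_self]
    exact prodNE_update k _ i (by simp) a x
  · rw [Function.update_of_ne hj]
    refine prodNE_congr k _ _ _ fun i' hi' => ?_
    rw [Function.update_of_ne]
    rintro rfl
    simp only [Finset.mem_filter, Finset.mem_univ, true_and] at hi'
    exact hj hi'.symm

/-- The multilinear map `(a_1, …, a_p) ↦ m_1 ⊗ … ⊗ m_q`. -/
def fiberMultilinear {p q : ℕ} (s : Fin p → Fin q) :
    MultilinearMap k (fun _ : Fin p => A) (⨂[k] _ : Fin q, A) where
  toFun a := PiTensorProduct.tprod k (fiberProd k s a)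
  map_update_add' {inst} a i x y := by
    obtain rfl : inst = instDecidableEqFin p := Subsingleton.elim _ _
    simp only [fiberProd_update, Unitization.inr_add, add_mul, Unitization.snd_add,
      MultilinearMap.map_update_add]
  map_update_smul' {inst} a i c x := by
    obtain rfl : inst = instDecidableEqFin p := Subsingleton.elim _ _
    simp only [fiberProd_update, Unitization.inr_smul, smul_mul_assoc, Unitization.snd_smul,
      MultilinearMap.map_update_smul]

theorem fiberProd_id {p : ℕ} (a : Fin p → A) : fiberProd k (id : Fin p → Fin p) a = a := by
  funext j
  have : (Finset.univ.filter fun i : Fin p => id i = j) = {j} := by ext; simp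
  rw [fiberProd, this, prodNE_singleton]

theorem fiberProd_comp {p q l : ℕ} (s : Fin p → Fin q) (hs : Function.Surjective s)
    (t : Fin q → Fin l) (ht : Function.Surjective t) (a : Fin p → A) :
    fiberProd k (t ∘ s) a = fiberProd k t (fiberProd k s a) := by
  funext j
  apply Unitization.inr_injective (R := k)
  have ne : ∀ {p q : ℕ} (s : Fin p → Fin q), Function.Surjective s → ∀ j,
      (Finset.univ.filter fun i => s i = j).Nonempty := fun s hs j => by
    obtain ⟨i, hi⟩ := hs j
    exact ⟨i, by simp [hi]⟩
  unfold fiberProd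
  rw [inr_prodNE k _ (ne _ (ht.comp hs) j), inr_prodNE k _ (ne _ ht j)]
  simp only [fun j => inr_prodNE k _ (ne _ hs j) a]
  rw [← Finset.prod_fiberwise_of_maps_to (g := s)
    (s := Finset.univ.filter fun i => (t ∘ s) i = j) (t := Finset.univ.filter fun i => t i = j)
    (by intro i; simp)]
  refine Finset.prod_congr rfl fun j' hj' => Finset.prod_congr ?_ fun _ _ => rfl
  simp only [Finset.mem_filter, Finset.mem_univ, true_and] at hj'
  ext i
  simp only [Finset.mem_filter, Finset.mem_univ, true_and, Function.comp_apply]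
  constructor
  · exact fun h => h.2
  · rintro rfl
    exact ⟨hj', rfl⟩

variable (A) in
/-- The representation `L^r(A) : Ω_r ⥤ k-Mod`, which sends `⟨p⟩` to `A^{⊗p}` and a surjection
`s : ⟨p⟩ → ⟨q⟩` to `a_1 ⊗ … ⊗ a_p ↦ m_1 ⊗ … ⊗ m_q`, where `m_j = ∏_{i ∈ s⁻¹(j)} a_i`. -/
def loday (r : ℕ) : Omega r ⥤ ModuleCat.{u} k where
  obj p := ModuleCat.of k (⨂[k] _ : Fin p.card, A)
  map {_ _} s := ModuleCat.ofHom (PiTensorProduct.lift (fiberMultilinear k s.1))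
  map_id p := by
    apply ModuleCat.hom_ext
    refine PiTensorProduct.ext (MultilinearMap.ext fun a => ?_)
    simp only [LinearMap.compMultilinearMap_apply, ModuleCat.hom_ofHom,
      PiTensorProduct.lift.tprod, ModuleCat.hom_id, LinearMap.id_apply]
    exact congrArg (PiTensorProduct.tprod k) (fiberProd_id k a)
  map_comp {_ _ _} s t := by
    apply ModuleCat.hom_ext
    refine PiTensorProduct.ext (MultilinearMap.ext fun a => ?_)
    simp only [LinearMap.compMultilinearMap_apply, ModuleCat.hom_ofHom,
      PiTensorProduct.lift.tprod, ModuleCat.hom_comp, LinearMap.comp_apply]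
    simp only [fiberMultilinear, MultilinearMap.coe_mk, PiTensorProduct.lift.tprod]
    exact congrArg (PiTensorProduct.tprod k) (fiberProd_comp k s.1 s.2 t.1 t.2 a)

variable {B : Type u} [NonUnitalCommRing B] [Module k B] [IsScalarTower k B B] [SMulCommClass k B B]

theorem map_fiberProd {p q : ℕ} (s : Fin p → Fin q) (hs : Function.Surjective s)
    (f : A →ₙₐ[k] B) (a : Fin p → A) (j : Fin q) :
    f (fiberProd k s a j) = fiberProd k s (fun i => f (a i)) j := by
  have key : ∀ F : Finset (Fin p), F.Nonempty →
      f (prodNE k F a) = prodNE k F (fun i => f (a i)) := by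
    intro F hF
    induction hF using Finset.Nonempty.cons_induction with
    | singleton i => rw [prodNE_singleton, prodNE_singleton]
    | cons i F hi hF ih =>
      rw [Finset.cons_eq_insert, prodNE_insert k F hF i hi, prodNE_insert k F hF i hi, map_mul, ih]
  refine key _ ?_
  obtain ⟨i, hi⟩ := hs j
  exact ⟨i, by simp [hi]⟩

/-- The morphism of representations `L^r(f) : L^r(A) ⟶ L^r(B)` induced by an algebra
homomorphism `f : A → B`; its component at `⟨p⟩` is `f^{⊗p}`. -/
def lodayMap (r : ℕ) (f : A →ₙₐ[k] B) : loday k A r ⟶ loday k B r where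
  app p := ModuleCat.ofHom (PiTensorProduct.map fun _ : Fin p.card => (f : A →ₗ[k] B))
  naturality {_ _} s := by
    apply ModuleCat.hom_ext
    refine PiTensorProduct.ext (MultilinearMap.ext fun a => ?_)
    change PiTensorProduct.map (fun _ => (f : A →ₗ[k] B))
        (PiTensorProduct.lift (fiberMultilinear k s.1) (PiTensorProduct.tprod k a)) =
      PiTensorProduct.lift (fiberMultilinear k s.1)
        (PiTensorProduct.map (fun _ => (f : A →ₗ[k] B)) (PiTensorProduct.tprod k a))
    rw [PiTensorProduct.map_tprod, PiTensorProduct.lift.tprod, PiTensorProduct.lift.tprod]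
    change PiTensorProduct.map (fun _ => (f : A →ₗ[k] B))
        (PiTensorProduct.tprod k (fiberProd k s.1 a)) =
      PiTensorProduct.tprod k (fiberProd k s.1 fun i => f (a i))
    rw [PiTensorProduct.map_tprod]
    exact congrArg (PiTensorProduct.tprod k) (funext fun j => map_fiberProd k s.1 s.2 f a j)

end Loday

/-! ## Graphs and their algebras -/

/-- A graph with vertex set `V`: a reflexive symmetric relation on `V`. -/
structure Graph (V : Type) where
  /-- the reflexive symmetric relation -/
  Rel : V → V → Prop
  refl : ∀ x, Rel x x
  symm : ∀ x y, Rel x y → Rel y x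

namespace Graph

variable {V W : Type}

/-- The relation `G_2 ⊆ G_1 × G_1` as a type. -/
abbrev Two (G : Graph V) : Type := {e : V × V // G.Rel e.1 e.2}

/-- The action of the transposition in `Σ_2` on `G_2`. -/
def Two.swap {G : Graph V} (e : G.Two) : G.Two := ⟨(e.1.2, e.1.1), G.symm _ _ e.2⟩

/-- A morphism of graphs: a map on vertices that preserves the relation. -/
structure Hom (G : Graph V) (H : Graph W) where
  /-- the map on vertices -/
  toFun : V → W
  rel : ∀ x y, G.Rel x y → H.Rel (toFun x) (toFun y)

/-- The map `f_2 : G_2 → H_2` of a morphism `f : G → H`. -/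
def Hom.two {G : Graph V} {H : Graph W} (f : Hom G H) (e : G.Two) : H.Two :=
  ⟨(f.toFun e.1.1, f.toFun e.1.2), f.rel _ _ e.2⟩

/-- The graph obtained from `G` by identifying vertices according to the relation `ρ`. -/
def quot (G : Graph V) (ρ : V → V → Prop) : Graph (Quot ρ) where
  Rel x y := ∃ x' y', G.Rel x' y' ∧ Quot.mk ρ x' = x ∧ Quot.mk ρ y' = y
  refl x := by
    obtain ⟨x', rfl⟩ := Quot.exists_rep x
    exact ⟨x', x', G.refl _, rfl, rfl⟩
  symm := by
    rintro _ _ ⟨x', y', h, rfl, rfl⟩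
    exact ⟨y', x', G.symm _ _ h, rfl, rfl⟩

end Graph

section GraphAlgebra

variable (k : Type u) [Field k] {V W : Type}

/-- The span of the differences `u - σ u`, `u ∈ k^{G_2}`, where `σ` is the transposition
in `Σ_2`. -/
def swapDiff (G : Graph V) : Submodule k (G.Two → k) :=
  LinearMap.range (LinearMap.id - LinearMap.funLeft k k (Graph.Two.swap (G := G)))

/-- The degree-2 component `(k^{G_2})_{Σ_2}` (coinvariants). -/
abbrev Deg2 (G : Graph V) : Type u := (G.Two → k) ⧸ swapDiff k G

/-- The underlying vector space `k^{G_1} ⊕ (k^{G_2})_{Σ_2}` of the algebra `Q(G)`. -/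
def Q (G : Graph V) : Type u := (V → k) × Deg2 k G

instance (G : Graph V) : AddCommGroup (Q k G) :=
  inferInstanceAs (AddCommGroup ((V → k) × Deg2 k G))

instance (G : Graph V) : Module k (Q k G) :=
  inferInstanceAs (Module k ((V → k) × Deg2 k G))

/-- The product `A^1 × A^1 → A^2`: `a b` is the class of the function `(x, y) ↦ a(x) b(y)`. -/
def mulDeg1 (G : Graph V) : (V → k) →ₗ[k] (V → k) →ₗ[k] Deg2 k G :=
  LinearMap.mk₂ k (fun a b => (swapDiff k G).mkQ fun e => a e.1.1 * b e.1.2)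
    (fun a a' b => by rw [← map_add]; congr 1; funext e; simp [add_mul])
    (fun c a b => by rw [← map_smul]; congr 1; funext e; simp [mul_assoc])
    (fun a b b' => by rw [← map_add]; congr 1; funext e; simp [mul_add])
    (fun c a b => by rw [← map_smul]; congr 1; funext e; simp [mul_left_comm])

theorem mulDeg1_comm (G : Graph V) (a b : V → k) : mulDeg1 k G a b = mulDeg1 k G b a := by
  refine (Submodule.Quotient.eq _).2 ⟨fun e => a e.1.1 * b e.1.2, ?_⟩
  funext e
  simp [LinearMap.funLeft, Graph.Two.swap, mul_comm]

/-- The multiplication of `Q(G)`: the product of two elements of degree 1 has degree 2,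
and all products involving an element of degree 2 vanish. -/
instance (G : Graph V) : Mul (Q k G) where
  mul a b := ((0 : V → k), mulDeg1 k G a.1 b.1)

theorem Q.mul_def (G : Graph V) (a b : Q k G) :
    a * b = (((0 : V → k), mulDeg1 k G a.1 b.1) : (V → k) × Deg2 k G) := rfl

instance (G : Graph V) : NonUnitalCommRing (Q k G) where
  left_distrib a b c := Prod.ext (add_zero _).symm ((mulDeg1 k G a.1).map_add b.1 c.1)
  right_distrib a b c := Prod.ext (add_zero _).symm ((mulDeg1 k G).map_add₂ a.1 b.1 c.1)
  zero_mul a := Prod.ext rfl ((mulDeg1 k G).map_zero₂ a.1)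
  mul_zero a := Prod.ext rfl (mulDeg1 k G a.1).map_zero
  mul_assoc a _ c := Prod.ext rfl
    (((mulDeg1 k G).map_zero₂ c.1).trans (mulDeg1 k G a.1).map_zero.symm)
  mul_comm a b := Prod.ext rfl (mulDeg1_comm k G a.1 b.1)

instance (G : Graph V) : IsScalarTower k (Q k G) (Q k G) where
  smul_assoc c a b := Prod.ext (smul_zero c).symm ((mulDeg1 k G).map_smul₂ c a.1 b.1)

instance (G : Graph V) : SMulCommClass k (Q k G) (Q k G) where
  smul_comm c a b := Prod.ext (smul_zero _) ((mulDeg1 k G a.1).map_smul c b.1).symm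

/-- The algebra homomorphism `Q(f) : Q(H) → Q(G)` induced by a morphism of graphs `f : G → H`:
it is induced by `a ↦ a ∘ f_1` in degree 1 and by `u ↦ u ∘ f_2` in degree 2. -/
def Qmap {G : Graph V} {H : Graph W} (f : G.Hom H) : Q k H →ₙₐ[k] Q k G where
  toFun := Prod.map (LinearMap.funLeft k k f.toFun)
    ((swapDiff k H).mapQ (swapDiff k G) (LinearMap.funLeft k k f.two) (by
      rintro _ ⟨u, rfl⟩
      exact ⟨fun e => u (f.two e), rfl⟩))
  map_smul' c a := Prod.ext (map_smul _ _ _) (map_smul _ _ _)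
  map_zero' := Prod.ext (map_zero _) (map_zero _)
  map_add' a b := Prod.ext (map_add _ _ _) (map_add _ _ _)
  map_mul' a b := Prod.ext (map_zero _) rfl

end GraphAlgebra

/-! ## The monoid `W_n` and the elements `T_n`, `Z_n`

Coordinates and levels, numbered `1, …, 2n+1` in the usual description, are indexed by
`Fin (2n+1)`, that is, by `0, …, 2n`; so the odd-numbered ones are those with an even index.
`𝐕 = {1, -1, 0}` is `SignType`, and `𝐔 = {1, -1}` is `SignTypeˣ`. -/

/-- The monoid `W_n ⊆ 𝐕^{2n+1}`: the entries in odd-numbered positions are `±1`, and the product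
of any two neighbouring entries is `1` or `0`. -/
def W (n : ℕ) : Submonoid (Fin (2 * n + 1) → SignType) where
  carrier := {w | (∀ j : Fin (2 * n + 1), Even (j : ℕ) → w j ≠ 0) ∧
    ∀ i j : Fin (2 * n + 1), (i : ℕ) + 1 = j → w i * w j ≠ -1}
  one_mem' := ⟨fun _ _ => by simp, fun _ _ _ => by simp⟩
  mul_mem' {v w} hv hw := by
    refine ⟨fun j hj => mul_ne_zero (hv.1 j hj) (hw.1 j hj), fun i j hij => ?_⟩
    have key : ∀ a b c d : SignType, a * b ≠ -1 → c * d ≠ -1 → a * c * (b * d) ≠ -1 := by decide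
    exact key _ _ _ _ (hv.2 i j hij) (hw.2 i j hij)

/-- `g_i = (+, …, +, 0, +, …, +)` with `0` in the position numbered `2i` (index `2i+1` for
`i : Fin n`, which is counted from `0`). -/
def g {n : ℕ} (i : Fin n) : W n :=
  ⟨fun j => if (j : ℕ) = 2 * i + 1 then 0 else 1, by
    constructor
    · intro j hj h
      dsimp only at h
      split_ifs at h with h'
      · rw [h'] at hj
        exact absurd hj (by simp)
    · intro a b hab
      dsimp only
      split_ifs <;> decide⟩

/-- `h_i = (-, …, -, 0, +, …, +)` with `0` in the position numbered `2i` (index `2i+1` for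
`i : Fin n`, which is counted from `0`). -/
def h {n : ℕ} (i : Fin n) : W n :=
  ⟨fun j => if (j : ℕ) < 2 * i + 1 then -1 else if (j : ℕ) = 2 * i + 1 then 0 else 1, by
    constructor
    · intro j hj h
      dsimp only at h
      split_ifs at h with h' h''
      · rw [h''] at hj
        exact absurd hj (by simp)
    · intro a b hab
      dsimp only
      split_ifs <;> first | decide | omega⟩

section Elements

variable (k : Type u) [Field k] (n : ℕ)

/-- The element `[w]` of the monoid algebra `k[W_n]`. -/
def elt {n : ℕ} (w : W n) : MonoidAlgebra k (W n) := MonoidAlgebra.of k (W n) w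

/-- `T_n = ∑_i (1 - [g_1]) ⋯ (1 - [g_{i-1}]) [h_i]`. -/
def T : MonoidAlgebra k (W n) :=
  ∑ i : Fin n, (∏ j ∈ Finset.Iio i, (1 - elt k (g j))) * elt k (h i)

/-- `Z_n = (1 - [g_1]) ⋯ (1 - [g_n])`. -/
def Z : MonoidAlgebra k (W n) := ∏ i : Fin n, (1 - elt k (g i))

end Elements

/-! ## The action of `W_n` on `𝐔` -/

/-- `W_n(s, t) = {w : w · s = t}` for the action `w · s = w_1 w_{2n+1} s` of `W_n` on `𝐔`. -/
def Whom (n : ℕ) (s t : SignTypeˣ) : Set (W n) :=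
  {w | w.1 0 * w.1 (Fin.last (2 * n)) * (s : SignType) = t}

theorem one_mem_Whom (n : ℕ) (s : SignTypeˣ) : 1 ∈ Whom n s s := by
  simp [Whom]

theorem mul_mem_Whom {n : ℕ} {s t u : SignTypeˣ} {v w : W n} (hw : w ∈ Whom n s t)
    (hv : v ∈ Whom n t u) : v * w ∈ Whom n s u := by
  simp only [Whom, Set.mem_ofPred_eq, Submonoid.coe_mul, Pi.mul_apply] at *
  rw [← hv, ← hw]
  simp only [mul_assoc, mul_left_comm]

theorem g_mem_Whom {n : ℕ} (i : Fin n) (s : SignTypeˣ) : g i ∈ Whom n s s := by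
  have h1 : ¬ (2 * n = 2 * (i : ℕ) + 1) := by omega
  simp [Whom, g, h1]

theorem h_mem_Whom {n : ℕ} (i : Fin n) (s : SignTypeˣ) : h i ∈ Whom n s (-s) := by
  have h1 : ¬ (2 * n = 2 * (i : ℕ) + 1) := by omega
  simp [Whom, h, h1]

section Supported

variable (k : Type u) [Field k] {n : ℕ}

/-- The subspace `k[W_n(s, t)] ⊆ k[W_n]`. -/
abbrev KWhom (n : ℕ) (s t : SignTypeˣ) : Submodule k (MonoidAlgebra k (W n)) :=
  MonoidAlgebra.supported k k (Whom n s t)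

theorem elt_mem {s t : SignTypeˣ} {w : W n} (hw : w ∈ Whom n s t) : elt k w ∈ KWhom k n s t := by
  rw [KWhom, MonoidAlgebra.supported_eq_span_single]
  exact Submodule.subset_span ⟨w, hw, rfl⟩

theorem mul_mem_KWhom {s t u : SignTypeˣ} {X Y : MonoidAlgebra k (W n)} (hX : X ∈ KWhom k n s t)
    (hY : Y ∈ KWhom k n t u) : Y * X ∈ KWhom k n s u := by
  rw [KWhom, MonoidAlgebra.supported_eq_span_single] at hX hY
  induction hX using Submodule.span_induction with
  | zero => rw [mul_zero]; exact Submodule.zero_mem _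
  | add x y _ _ hx hy => rw [mul_add]; exact Submodule.add_mem _ hx hy
  | smul c x _ hx => rw [mul_smul_comm]; exact Submodule.smul_mem _ _ hx
  | mem x hx =>
    obtain ⟨w, hw, rfl⟩ := hx
    induction hY using Submodule.span_induction with
    | zero => rw [zero_mul]; exact Submodule.zero_mem _
    | add x y _ _ hx hy => rw [add_mul]; exact Submodule.add_mem _ hx hy
    | smul c x _ hx => rw [smul_mul_assoc]; exact Submodule.smul_mem _ _ hx
    | mem y hy =>
      obtain ⟨v, hv, rfl⟩ := hy
      simp only [MonoidAlgebra.single_mul_single, mul_one]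
      exact elt_mem k (mul_mem_Whom hw hv)

theorem one_mem_KWhom (s : SignTypeˣ) : (1 : MonoidAlgebra k (W n)) ∈ KWhom k n s s := by
  have := elt_mem k (one_mem_Whom n s)
  rwa [elt, map_one] at this

theorem prod_mem_KWhom (F : Finset (Fin n)) (s : SignTypeˣ) :
    ∏ j ∈ F, (1 - elt k (g j)) ∈ KWhom k n s s := by
  induction F using Finset.induction_on with
  | empty => rw [Finset.prod_empty]; exact one_mem_KWhom k s
  | insert j F hj ih =>
    rw [Finset.prod_insert hj]
    exact mul_mem_KWhom k ih
      (Submodule.sub_mem _ (one_mem_KWhom k s) (elt_mem k (g_mem_Whom j s)))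

theorem T_mem (n : ℕ) (s t : SignTypeˣ) (hst : t = -s) : T k n ∈ KWhom k n s t := by
  subst hst
  exact Submodule.sum_mem _ fun i _ =>
    mul_mem_KWhom k (elt_mem k (h_mem_Whom i s)) (prod_mem_KWhom k _ (-s))

theorem Z_mem (n : ℕ) (s : SignTypeˣ) : Z k n ∈ KWhom k n s s := prod_mem_KWhom k _ s

end Supported

/-! ## The graph `B_n` and the crowns -/

/-- The vertices `x_j^v` of `B_n`: `v ∈ 𝐕`, and `v ∈ 𝐔` if `j` is odd (i.e. has even index). -/
abbrev BVertex (n : ℕ) : Type :=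
  {x : Fin (2 * n + 1) × SignType // Even (x.1 : ℕ) → x.2 ≠ 0}

/-- The graph `B_n`: its edges join the vertices `x_j^u` and `x_{j+1}^v` of consecutive levels with
`u v ∈ {1, 0}`, i.e. with `u = v` or with one of `u`, `v` equal to `0`. -/
def B (n : ℕ) : Graph (BVertex n) where
  Rel x y := x = y ∨
    (((x.1.1 : ℕ) + 1 = y.1.1 ∨ (y.1.1 : ℕ) + 1 = x.1.1) ∧ x.1.2 * y.1.2 ≠ -1)
  refl _ := Or.inl rfl
  symm x y hxy := hxy.imp Eq.symm fun hh => ⟨hh.1.symm, by rw [mul_comm]; exact hh.2⟩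

/-- The action of `w ∈ W_n` on `B_n`: `w · x_j^v = x_j^{w_j v}`. -/
def actB {n : ℕ} (w : W n) : (B n).Hom (B n) where
  toFun x := ⟨(x.1.1, w.1 x.1.1 * x.1.2), fun hj => mul_ne_zero (w.2.1 _ hj) (x.2 hj)⟩
  rel x y := by
    have key : ∀ a b c d : SignType, a * b ≠ -1 → c * d ≠ -1 → a * c * (b * d) ≠ -1 := by decide
    rintro (rfl | ⟨hj, hv⟩)
    · exact Or.inl rfl
    · refine Or.inr ⟨hj, key _ _ _ _ ?_ hv⟩
      rcases hj with hj | hj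
      · exact w.2.2 _ _ hj
      · rw [mul_comm]
        exact w.2.2 _ _ hj

/-- The identification of `x_{2n+1}^v` with `x_1^{s v}`, `v ∈ 𝐔`. -/
def glue (n : ℕ) (s : SignTypeˣ) (x y : BVertex n) : Prop :=
  x.1.1 = Fin.last (2 * n) ∧ y.1.1 = 0 ∧ y.1.2 = (s : SignType) * x.1.2

/-- The crown `C_n^s` (for `n ≥ 2`): the simple crown for `s = 1`, the Möbius crown for `s = -1`.
It is obtained from `B_n` by identifying `x_{2n+1}^v` with `x_1^{s v}` for each `v ∈ 𝐔`. -/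
def C (n : ℕ) (s : SignTypeˣ) : Graph (Quot (glue n s)) := (B n).quot (glue n s)

/-- The morphism `w_* : C_n^s → C_n^t` induced by the action of `w ∈ W_n(s, t)` on `B_n`. -/
def actC {n : ℕ} {s t : SignTypeˣ} (w : Whom n s t) : (C n s).Hom (C n t) where
  toFun := Quot.map (actB w.1).toFun (by
    rintro x y ⟨hx, hy, hxy⟩
    refine ⟨hx, hy, ?_⟩
    have hw : w.1.1 0 * w.1.1 (Fin.last (2 * n)) * (s : SignType) = t := w.2
    have h0 : w.1.1 (Fin.last (2 * n)) ≠ 0 := w.1.2.1 _ (even_two_mul n)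
    have key : ∀ a b c v : SignType, b ≠ 0 → a * (c * v) = a * b * c * (b * v) := by decide
    change w.1.1 y.1.1 * y.1.2 = t * (w.1.1 x.1.1 * x.1.2)
    rw [hx, hy, hxy, ← hw]
    exact key _ _ _ _ h0)
  rel := by
    rintro _ _ ⟨x, y, hxy, rfl, rfl⟩
    exact ⟨_, _, (actB w.1).rel x y hxy, rfl, rfl⟩

/-! ## The linear extensions -/

section Linear

variable (k : Type u) [Field k] {n : ℕ}

/-- The action of `X ∈ k[W_n]` on `L^r(Q(B_n))`: the linear extension of `w ↦ L^r(Q(w_*))`. -/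
def bRep (n r : ℕ) : MonoidAlgebra k (W n) →ₗ[k]
    (loday k (Q k (B n)) r ⟶ loday k (Q k (B n)) r) :=
  (Finsupp.linearCombination k fun w : W n => lodayMap k r (Qmap k (actB w))) ∘ₗ
    (MonoidAlgebra.coeffLinearEquiv k).toLinearMap

/-- The morphism `L^r(Q(C_n^t)) ⟶ L^r(Q(C_n^s))` given by `X ∈ k[W_n(s, t)]`: the linear extension
of `w ↦ L^r(Q(w_*))`, where `w_* : C_n^s → C_n^t`. -/
def cRep (n r : ℕ) (s t : SignTypeˣ) : KWhom k n s t →ₗ[k]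
    (loday k (Q k (C n t)) r ⟶ loday k (Q k (C n s)) r) :=
  (Finsupp.linearCombination k fun w : Whom n s t => lodayMap k r (Qmap k (actC w))) ∘ₗ
    (MonoidAlgebra.supportedEquivFinsupp (Whom n s t)).toLinearMap

end Linear

end MobiusCrown

end

open CategoryTheory
open scoped TensorProduct

noncomputable section

namespace MobiusCrown

universe u

/-! ### Identities in the monoid algebra of `W n` -/

section Elements

variable (k : Type u) [Field k] {n : ℕ}

/-! Each `h i` reverses the sign s of a crown, so `T` gives maps between the representations of the
two crowns in both directions. In the commutative algebra k[W_n] the relations g_i² = g_i, g_i h_i =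
h_i and h_i² = g_i make distinct summands of `T` orthogonal. The squares of the summands telescope,
and T² = 1 - Z (`T_sq`). It remains to see that Z acts as 0.

This is a locality argument (`eq_zero_of_factors`, `span_fixed_eq_top`). Q(G) is spanned by
indicators of vertices and classes of indicators of edges. An edge has at most one end on an
even-numbered level, and `g j` alters only the level numbered 2j, so each spanning element is moved
by at most one of g_1, …, g_n. A tensor of p ≤ r < n such elements is therefore fixed by some g_i
and killed by 1 - g_i, a factor of Z.

The algebras are told apart by annihilators. The codimension of Ann(a) is the size of the closed
neighbourhood of the support of the degree-1 part of a, and Ann(a) + Ann(b) is proper exactly when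
two such neighbourhoods meet (`finrank_quotient_annih`, `annih_sup_ne_top_iff`). In a crown,
codimension 3 singles out the vertices of nonzero sign on even-numbered levels (`isThin_iff`).
Linked when their neighbourhoods meet, they form a strand for each sign. The strands close up
separately in the simple crown and join into one in the Möbius crown, so `ThinConnected` holds only
for the latter. -/

theorem elt_mul (v w : W n) : elt k v * elt k w = elt k (v * w) :=
  (map_mul (MonoidAlgebra.of k (W n)) v w).symm

theorem g_mul_g (i : Fin n) : g i * g i = g i := by
  ext j
  simp only [g, Submonoid.coe_mul, Pi.mul_apply]
  split_ifs <;> rfl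

theorem g_mul_h (i : Fin n) : g i * h i = h i := by
  ext j
  simp only [g, h, Submonoid.coe_mul, Pi.mul_apply]
  split_ifs <;> first | rfl | omega

theorem h_mul_h (i : Fin n) : h i * h i = g i := by
  ext j
  simp only [g, h, Submonoid.coe_mul, Pi.mul_apply]
  split_ifs <;> first | rfl | omega

theorem one_sub_g_mul_self (i : Fin n) :
    (1 - elt k (g i)) * (1 - elt k (g i)) = 1 - elt k (g i) := by
  have := elt_mul k (g i) (g i)
  rw [g_mul_g] at this
  rw [mul_sub, mul_one, sub_mul, one_mul, this]
  abel

theorem one_sub_g_mul_h (i : Fin n) : (1 - elt k (g i)) * elt k (h i) = 0 := by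
  rw [sub_mul, one_mul, elt_mul, g_mul_h, sub_self]

theorem prod_one_sub_g_mul_self (F : Finset (Fin n)) :
    (∏ j ∈ F, (1 - elt k (g j))) * ∏ j ∈ F, (1 - elt k (g j)) = ∏ j ∈ F, (1 - elt k (g j)) := by
  rw [← Finset.prod_mul_distrib]
  exact Finset.prod_congr rfl fun j _ => one_sub_g_mul_self k j

/-- Distinct summands of `T_n` are orthogonal. -/
theorem T_summand_mul_eq_zero {i j : Fin n} (hij : i < j) :
    (∏ l ∈ Finset.Iio i, (1 - elt k (g l))) * elt k (h i) *
      ((∏ l ∈ Finset.Iio j, (1 - elt k (g l))) * elt k (h j)) = 0 := by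
  -- Since i < j, the second prefactor contains 1 - g_i, which annihilates h_i.
  rw [← Finset.mul_prod_erase (Finset.Iio j) _ (Finset.mem_Iio.2 hij)]
  linear_combination (∏ l ∈ Finset.Iio i, (1 - elt k (g l))) *
    (∏ l ∈ (Finset.Iio j).erase i, (1 - elt k (g l))) * elt k (h j) * one_sub_g_mul_h k i

theorem T_summand_mul_self (i : Fin n) :
    (∏ l ∈ Finset.Iio i, (1 - elt k (g l))) * elt k (h i) *
      ((∏ l ∈ Finset.Iio i, (1 - elt k (g l))) * elt k (h i)) =
    (∏ l ∈ Finset.Iio i, (1 - elt k (g l))) * elt k (g i) := by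
  have h1 := elt_mul k (h i) (h i)
  rw [h_mul_h] at h1
  rw [mul_mul_mul_comm, prod_one_sub_g_mul_self, h1]

/-- A telescoping sum: with P_i the product of the 1 - x_l over l < i, each summand is P_i -
P_{i+1}. -/
theorem sum_prod_one_sub_mul {R : Type*} [CommRing R] (n : ℕ) (x : Fin n → R) :
    ∑ i, (∏ l ∈ Finset.Iio i, (1 - x l)) * x i = 1 - ∏ i, (1 - x i) := by
  have h1 := Finset.prod_one_sub_ordered (Finset.univ : Finset (Fin n)) x
  rw [h1, sub_sub_cancel]
  refine Finset.sum_congr rfl fun i _ => ?_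
  rw [mul_comm]
  congr 2
  ext l
  simp

theorem T_sq (n : ℕ) : T k n ^ 2 = 1 - Z k n := by
  rw [Z, ← sum_prod_one_sub_mul, sq, T, Finset.sum_mul_sum]
  refine Finset.sum_congr rfl fun i _ => ?_
  refine (Finset.sum_eq_single i (fun j _ hj => ?_) (by simp)).trans (T_summand_mul_self k i)
  rcases lt_or_gt_of_ne hj with hj | hj
  · exact (mul_comm _ _).trans (T_summand_mul_eq_zero k hj)
  · exact T_summand_mul_eq_zero k hj

/-- Any one of the factors 1 - g_i can be put first; this supplies the factorizations demanded by
`eq_zero_of_factors`. -/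
theorem Z_eq_mul (i : Fin n) :
    Z k n = (1 - elt k (g i)) * ∏ j ∈ Finset.univ.erase i, (1 - elt k (g j)) :=
  (Finset.mul_prod_erase _ _ (Finset.mem_univ i)).symm

end Elements

/-! ## Functoriality -/

section Functoriality

variable (k : Type u) [Field k]

section

variable {A B C : Type u} [NonUnitalCommRing A] [Module k A] [IsScalarTower k A A]
  [SMulCommClass k A A] [NonUnitalCommRing B] [Module k B] [IsScalarTower k B B]
  [SMulCommClass k B B] [NonUnitalCommRing C] [Module k C] [IsScalarTower k C C]
  [SMulCommClass k C C]

theorem lodayMap_app_tprod (r : ℕ) (f : A →ₙₐ[k] B) (p : Omega r) (a : Fin p.card → A) :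
    ((lodayMap k r f).app p).hom (PiTensorProduct.tprod k a) =
      PiTensorProduct.tprod k fun i => f (a i) :=
  PiTensorProduct.map_tprod _ _

/-- Morphisms out of `L^r(A)` are determined by their values on elementary tensors. -/
theorem loday_hom_ext {r : ℕ} {F : Omega r ⥤ ModuleCat.{u} k} {φ ψ : loday k A r ⟶ F}
    (H : ∀ (p : Omega r) (a : Fin p.card → A),
      (φ.app p).hom (PiTensorProduct.tprod k a) = (ψ.app p).hom (PiTensorProduct.tprod k a)) :
    φ = ψ := by
  apply NatTrans.ext
  funext p
  apply ModuleCat.hom_ext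
  exact PiTensorProduct.ext (MultilinearMap.ext fun a => H p a)

theorem lodayMap_id (r : ℕ) (f : A →ₙₐ[k] A) (hf : ∀ a, f a = a) :
    lodayMap k r f = 𝟙 (loday k A r) := by
  refine loday_hom_ext k fun p a => ?_
  rw [lodayMap_app_tprod]
  simp only [hf]
  rfl

theorem lodayMap_comp (r : ℕ) (f : A →ₙₐ[k] B) (f' : B →ₙₐ[k] C) (f'' : A →ₙₐ[k] C)
    (hf : ∀ a, f' (f a) = f'' a) : lodayMap k r f ≫ lodayMap k r f' = lodayMap k r f'' := by
  refine loday_hom_ext k fun p a => ?_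
  change ((lodayMap k r f').app p).hom (((lodayMap k r f).app p).hom (PiTensorProduct.tprod k a)) = _
  rw [lodayMap_app_tprod, lodayMap_app_tprod, lodayMap_app_tprod]
  simp only [hf]
  rfl

end

variable {V₁ V₂ V₃ : Type} {G : Graph V₁} {H : Graph V₂} {K : Graph V₃}

theorem Qmap_mk (f : G.Hom H) (a : V₂ → k) (u : H.Two → k) :
    Qmap k f ((a, (swapDiff k H).mkQ u) : (V₂ → k) × Deg2 k H) =
      (((fun x => a (f.toFun x)), (swapDiff k G).mkQ fun e => u (f.two e)) :
        (V₁ → k) × Deg2 k G) := rfl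

theorem Q.exists_rep (a : Q k G) : ∃ (b : V₁ → k) (u : G.Two → k),
    a = ((b, (swapDiff k G).mkQ u) : (V₁ → k) × Deg2 k G) := by
  obtain ⟨u, hu⟩ := (swapDiff k G).mkQ_surjective a.2
  exact ⟨a.1, u, Prod.ext rfl hu.symm⟩

theorem Qmap_id (f : G.Hom G) (hf : ∀ x, f.toFun x = x) (a : Q k G) : Qmap k f a = a := by
  obtain ⟨b, u, rfl⟩ := Q.exists_rep k a
  rw [Qmap_mk]
  have : ∀ e : G.Two, f.two e = e := fun e => Subtype.ext (Prod.ext (hf _) (hf _))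
  simp only [hf, this]
  rfl

theorem Qmap_comp (f : G.Hom H) (f' : H.Hom K) (f'' : G.Hom K)
    (hf : ∀ x, f'.toFun (f.toFun x) = f''.toFun x) (a : Q k K) :
    Qmap k f (Qmap k f' a) = Qmap k f'' a := by
  obtain ⟨b, u, rfl⟩ := Q.exists_rep k a
  rw [Qmap_mk, Qmap_mk, Qmap_mk]
  have : ∀ e : G.Two, f'.two (f.two e) = f''.two e := fun e => Subtype.ext (Prod.ext (hf _) (hf _))
  simp only [hf, this]
  rfl

end Functoriality

/-! ## The linear extensions are functorial -/

section Linear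

variable (k : Type u) [Field k] {n : ℕ}

theorem actB_mul (v w : W n) (x : BVertex n) :
    (actB v).toFun ((actB w).toFun x) = (actB (v * w)).toFun x :=
  Subtype.ext (Prod.ext rfl (mul_assoc _ _ _).symm)

theorem actB_one (x : BVertex n) : (actB (1 : W n)).toFun x = x :=
  Subtype.ext (Prod.ext rfl (one_mul _))

theorem actC_mk {s t : SignTypeˣ} (w : Whom n s t) (x : BVertex n) :
    (actC w).toFun (Quot.mk _ x) = Quot.mk _ ((actB w.1).toFun x) := rfl

theorem actC_mul {s t u : SignTypeˣ} (v : Whom n t u) (w : Whom n s t)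
    (x : Quot (glue n s)) :
    (actC v).toFun ((actC w).toFun x) = (actC ⟨v.1 * w.1, mul_mem_Whom w.2 v.2⟩).toFun x := by
  induction x using Quot.ind with | mk x
  rw [actC_mk, actC_mk, actC_mk, actB_mul]

theorem actC_one {s : SignTypeˣ} (x : Quot (glue n s)) :
    (actC ⟨1, one_mem_Whom n s⟩).toFun x = x := by
  induction x using Quot.ind with | mk x
  rw [actC_mk, actB_one]

theorem bRep_elt (r : ℕ) (w : W n) :
    bRep k n r (elt k w) = lodayMap k r (Qmap k (actB w)) := by
  simp [bRep, elt]

theorem supportedEquivFinsupp_elt {s t : SignTypeˣ} (w : W n) (hw : w ∈ Whom n s t) :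
    MonoidAlgebra.supportedEquivFinsupp (Whom n s t) ⟨elt k w, elt_mem k hw⟩ =
      Finsupp.single (⟨w, hw⟩ : Whom n s t) (1 : k) := by
  classical
  refine Finsupp.ext fun w' => ?_
  change (Finsupp.single w (1 : k)) w'.1 = _
  rw [Finsupp.single_apply, Finsupp.single_apply]
  exact if_congr ⟨fun h1 => Subtype.ext h1, fun h1 => congrArg Subtype.val h1⟩ rfl rfl

theorem cRep_elt (r : ℕ) {s t : SignTypeˣ} (w : W n) (hw : w ∈ Whom n s t) :
    cRep k n r s t ⟨elt k w, elt_mem k hw⟩ = lodayMap k r (Qmap k (actC ⟨w, hw⟩)) := by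
  rw [cRep, LinearMap.comp_apply, LinearEquiv.coe_coe, supportedEquivFinsupp_elt,
    Finsupp.linearCombination_single, one_smul]

/-- Linear maps on `k[W_n(s, t)]` are determined by their values on `W_n(s, t)`. -/
theorem KWhom_linearMap_ext {s t : SignTypeˣ} {M : Type*} [AddCommGroup M] [Module k M]
    {φ ψ : KWhom k n s t →ₗ[k] M}
    (H : ∀ (w : W n) (hw : w ∈ Whom n s t), φ ⟨elt k w, elt_mem k hw⟩ = ψ ⟨elt k w, elt_mem k hw⟩) :
    φ = ψ := by
  set e := MonoidAlgebra.supportedEquivFinsupp (R := k) (S := k) (Whom n s t) with he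
  have h1 : φ ∘ₗ e.symm.toLinearMap = ψ ∘ₗ e.symm.toLinearMap := by
    refine Finsupp.lhom_ext' fun w => LinearMap.ext_ring ?_
    change φ (e.symm (Finsupp.single w 1)) = ψ (e.symm (Finsupp.single w 1))
    rw [← supportedEquivFinsupp_elt k w.1 w.2, e.symm_apply_apply]
    exact H w.1 w.2
  ext X
  simpa using LinearMap.congr_fun h1 (e X)

/-- Multiplication `k[W_n(s, t)] × k[W_n(t, u)] → k[W_n(s, u)]`. -/
def KWhom.mul (s t u : SignTypeˣ) :
    KWhom k n s t →ₗ[k] KWhom k n t u →ₗ[k] KWhom k n s u :=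
  LinearMap.mk₂ k (fun X Y => ⟨Y.1 * X.1, mul_mem_KWhom k X.2 Y.2⟩)
    (fun _ _ _ => Subtype.ext (mul_add _ _ _))
    (fun _ _ _ => Subtype.ext (mul_smul_comm _ _ _))
    (fun _ _ _ => Subtype.ext (add_mul _ _ _))
    (fun _ _ _ => Subtype.ext (smul_mul_assoc _ _ _))

theorem bRep_mul (r : ℕ) (X Y : MonoidAlgebra k (W n)) :
    bRep k n r (Y * X) = bRep k n r Y ≫ bRep k n r X := by
  induction X using MonoidAlgebra.induction_linear with
  | zero => simp
  | add X X' h1 h2 => rw [mul_add, map_add, map_add, h1, h2, Preadditive.comp_add]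
  | single w a =>
    induction Y using MonoidAlgebra.induction_linear with
    | zero => simp
    | add Y Y' h1 h2 => rw [add_mul, map_add, map_add, h1, h2, Preadditive.add_comp]
    | single v b =>
      have h0 : ∀ (w : W n) (a : k), MonoidAlgebra.single w a = a • elt k w := by
        intro w a
        simp [elt]
      rw [h0, h0, smul_mul_smul_comm, elt_mul, mul_comm b a]
      simp only [map_smul, bRep_elt, Linear.smul_comp, Linear.comp_smul, smul_smul]
      rw [lodayMap_comp k r _ _ _ (Qmap_comp k (actB w) (actB v) _ (actB_mul v w))]

theorem cRep_mul (r : ℕ) {s t u : SignTypeˣ} (X : KWhom k n s t) (Y : KWhom k n t u) :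
    cRep k n r s u ⟨Y.1 * X.1, mul_mem_KWhom k X.2 Y.2⟩ =
      cRep k n r t u Y ≫ cRep k n r s t X := by
  -- Both sides are bilinear, so it suffices to compare them on monoid elements. As Q is
  -- contravariant, the left factor Y of the product acts first.
  have H : (KWhom.mul k s t u).compr₂ (cRep k n r s u) =
      (Linear.comp (S := k) _ _ _).flip.compl₁₂ (cRep k n r s t) (cRep k n r t u) := by
    refine KWhom_linearMap_ext k fun w hw => KWhom_linearMap_ext k fun v hv => ?_
    change cRep k n r s u ⟨elt k v * elt k w, _⟩ =
      cRep k n r t u ⟨elt k v, _⟩ ≫ cRep k n r s t ⟨elt k w, _⟩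
    rw [cRep_elt k r v hv, cRep_elt k r w hw, lodayMap_comp k r _ _ _
      (Qmap_comp k (actC ⟨w, hw⟩) (actC ⟨v, hv⟩) _ (actC_mul ⟨v, hv⟩ ⟨w, hw⟩)), ← cRep_elt]
    congr 2
    exact elt_mul k v w
  exact LinearMap.congr_fun₂ H X Y

theorem bRep_one (r : ℕ) : bRep k n r 1 = 𝟙 _ := by
  have h1 : (1 : MonoidAlgebra k (W n)) = elt k 1 := (map_one _).symm
  rw [h1, bRep_elt, lodayMap_id k r _ (Qmap_id k _ actB_one)]

theorem cRep_one (r : ℕ) (s : SignTypeˣ) : cRep k n r s s ⟨1, one_mem_KWhom k s⟩ = 𝟙 _ := by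
  rw [← lodayMap_id k r _ (Qmap_id k _ actC_one), ← cRep_elt]
  rfl

end Linear

/-! ## The vanishing of `Z_n` -/

section Vanishing

variable (k : Type u) [Field k]

/-- If `A` is spanned by elements each of which is moved by at most one of the endomorphisms
`f_1, …, f_n`, and `r < n`, then a morphism out of `L^r(A)` that factors through each
`1 - L^r(f_i)` is zero. -/
theorem eq_zero_of_factors {A : Type u} [NonUnitalCommRing A] [Module k A] [IsScalarTower k A A]
    [SMulCommClass k A A] {n r : ℕ} (hrn : r < n) (f : Fin n → A →ₙₐ[k] A)
    (hf : Submodule.span k {a : A | ∃ i, ∀ j, j ≠ i → f j a = a} = ⊤)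
    {F : Omega r ⥤ ModuleCat.{u} k} (φ : loday k A r ⟶ F)
    (hφ : ∀ i, ∃ ψ : loday k A r ⟶ F, φ = (𝟙 _ - lodayMap k r (f i)) ≫ ψ) : φ = 0 := by
  apply NatTrans.ext
  funext p
  apply ModuleCat.hom_ext
  refine PiTensorProduct.ext (MultilinearMap.ext_of_span_eq_top
    (γ := fun _ => {a : A | ∃ i, ∀ j, j ≠ i → f j a = a}) (g := fun _ a => a.1)
    (fun _ => by rw [Subtype.range_coe]; exact hf) fun a => ?_)
  -- Only the endomorphism with index `c l` can move the l-th tensor factor. There are p ≤ r < n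
  -- factors, so some index i is missed by `c`, and `f i` fixes the whole tensor.
  choose c hc using fun l => (a l).2
  obtain ⟨i, hi⟩ : ∃ i, i ∉ Set.range c := by
    by_contra! hsurj
    have := Fintype.card_le_of_surjective c hsurj
    simp only [Fintype.card_fin] at this
    exact absurd (this.trans p.le) (by omega)
  obtain ⟨ψ, rfl⟩ := hφ i
  let t : (loday k A r).obj p := PiTensorProduct.tprod k fun l => (a l).1
  have h1 : ((lodayMap k r (f i)).app p).hom t = t := by
    refine (lodayMap_app_tprod k r (f i) p _).trans (congrArg (PiTensorProduct.tprod k) ?_)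
    funext l
    exact hc l i fun h1 => hi ⟨l, h1.symm⟩
  change (ψ.app p).hom (t - ((lodayMap k r (f i)).app p).hom t) = 0
  rw [h1, sub_self]
  exact map_zero _

variable {V : Type} [Finite V] {G : Graph V}

/-- `Q(G)` is spanned by the classes of the indicator functions of vertices and edges. -/
theorem Q.eq_top_of_single_mem [DecidableEq V] [DecidableEq G.Two] (S : Submodule k (Q k G))
    (h1 : ∀ x, ((Pi.single x 1, 0) : (V → k) × Deg2 k G) ∈ S)
    (h2 : ∀ e : G.Two, ((0, (swapDiff k G).mkQ (Pi.single e 1)) : (V → k) × Deg2 k G) ∈ S) :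
    S = ⊤ := by
  let i₁ : (V → k) →ₗ[k] Q k G := LinearMap.inl k (V → k) (Deg2 k G)
  let i₂ : (G.Two → k) →ₗ[k] Q k G := LinearMap.inr k (V → k) (Deg2 k G) ∘ₗ (swapDiff k G).mkQ
  have h3 : S.mkQ ∘ₗ i₁ = 0 := LinearMap.pi_ext' fun x => LinearMap.ext_ring
    ((Submodule.Quotient.mk_eq_zero S).2 (h1 x))
  have h4 : S.mkQ ∘ₗ i₂ = 0 := LinearMap.pi_ext' fun x => LinearMap.ext_ring
    ((Submodule.Quotient.mk_eq_zero S).2 (h2 x))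
  refine eq_top_iff.2 fun a _ => ?_
  obtain ⟨b, u, rfl⟩ := Q.exists_rep k a
  have h5 : ((b, (swapDiff k G).mkQ u) : (V → k) × Deg2 k G) = i₁ b + i₂ u :=
    Prod.ext (add_zero _).symm (zero_add _).symm
  have h6 : i₁ b ∈ S := (Submodule.Quotient.mk_eq_zero S).1 (LinearMap.congr_fun h3 b)
  have h7 : i₂ u ∈ S := (Submodule.Quotient.mk_eq_zero S).1 (LinearMap.congr_fun h4 u)
  exact h5 ▸ S.add_mem h6 h7

/-- If each edge of `G` is affected by at most one of the endomorphisms `γ_1, …, γ_n` of `G`, then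
`Q(G)` is spanned by elements moved by at most one of the `Q(γ_i)`. -/
theorem span_fixed_eq_top {n : ℕ} (γ : Fin n → G.Hom G)
    (H : ∀ x y, G.Rel x y → ∃ i, ∀ j, j ≠ i →
      (∀ x', (γ j).toFun x' = x ↔ x' = x) ∧ ∀ y', (γ j).toFun y' = y ↔ y' = y) :
    Submodule.span k {a : Q k G | ∃ i, ∀ j, j ≠ i → Qmap k (γ j) a = a} = ⊤ := by
  classical
  refine Q.eq_top_of_single_mem k _ (fun x => Submodule.subset_span ?_)
    fun e => Submodule.subset_span ?_
  · obtain ⟨i, hi⟩ := H x x (G.refl x)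
    refine ⟨i, fun j hj => ?_⟩
    have h1 := Qmap_mk k (γ j) (Pi.single x 1) 0
    rw [map_zero] at h1
    -- The pullback of the indicator of x is the indicator of the fibre over x. It is unchanged
    -- because `H` says that the fibre is {x}: x is fixed and no other vertex is sent to it.
    refine h1.trans (Prod.ext ?_ (map_zero _))
    funext y
    simp only [Pi.single_apply, (hi j hj).1]
  · obtain ⟨i, hi⟩ := H e.1.1 e.1.2 e.2
    refine ⟨i, fun j hj => (Qmap_mk k (γ j) 0 (Pi.single e 1)).trans (Prod.ext rfl ?_)⟩
    have h1 : ∀ e', (γ j).two e' = e ↔ e' = e := fun e' => by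
      simp only [Subtype.ext_iff, Prod.ext_iff]
      exact and_congr ((hi j hj).1 _) ((hi j hj).2 _)
    change (swapDiff k G).mkQ _ = (swapDiff k G).mkQ _
    congr 1
    funext e'
    simp only [Pi.single_apply, h1]

end Vanishing

/-! ### The action of the `g i` on `B n` and on the crowns -/

section

variable {n : ℕ}

theorem actB_g_of_ne (j : Fin n) (x : BVertex n) (hx : (x.1.1 : ℕ) ≠ 2 * j + 1) :
    (actB (g j)).toFun x = x := by
  refine Subtype.ext (Prod.ext rfl ?_)
  change (if (x.1.1 : ℕ) = 2 * j + 1 then (0 : SignType) else 1) * x.1.2 = x.1.2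
  rw [if_neg hx, one_mul]

theorem actB_g_eq_iff (j : Fin n) (x : BVertex n) (hx : (x.1.1 : ℕ) ≠ 2 * j + 1) (x' : BVertex n) :
    (actB (g j)).toFun x' = x ↔ x' = x := by
  constructor
  · rintro rfl
    exact (actB_g_of_ne j x' hx).symm
  · rintro rfl
    exact actB_g_of_ne j x' hx

/-- Being at the (unglued) level `2j`. -/
def atLevel (s : SignTypeˣ) (j : Fin n) : Quot (glue n s) → Prop :=
  Quot.lift (fun x => (x.1.1 : ℕ) = 2 * j + 1) (by
    rintro x y ⟨hx, hy, -⟩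
    have := j.2
    simp only [hx, hy, Fin.val_last, Fin.val_zero, eq_iff_iff]
    omega)

theorem actC_g_eq_iff (s : SignTypeˣ) (j : Fin n) (x : BVertex n) (hx : (x.1.1 : ℕ) ≠ 2 * j + 1)
    (x' : Quot (glue n s)) :
    (actC ⟨g j, g_mem_Whom j s⟩).toFun x' = Quot.mk _ x ↔ x' = Quot.mk _ x := by
  induction x' using Quot.ind with | mk x'
  rw [actC_mk]
  by_cases hx' : (x'.1.1 : ℕ) = 2 * j + 1
  -- The level numbered 2j is not glued and is preserved by `g j`. Hence neither x' nor its image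
  -- can be the class of x, and both sides are false.
  · have h1 : ∀ z : BVertex n, (z.1.1 : ℕ) = 2 * j + 1 →
        (Quot.mk (glue n s) z ≠ Quot.mk _ x) := fun z hz hzx =>
      hx ((iff_of_eq (congrArg (atLevel s j) hzx)).1 hz)
    exact iff_of_false (h1 _ hx') (h1 _ hx')
  · rw [actB_g_of_ne j x' hx']

/-- Each edge of `B_n` has at most one end on a level numbered `2j`. -/
theorem exists_level_of_rel (hn : 0 < n) {x y : BVertex n} (hxy : (B n).Rel x y) :
    ∃ i : Fin n, ∀ j, j ≠ i → (x.1.1 : ℕ) ≠ 2 * j + 1 ∧ (y.1.1 : ℕ) ≠ 2 * j + 1 := by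
  have h1 : x.1.1 = y.1.1 ∨ (x.1.1 : ℕ) + 1 = y.1.1 ∨ (y.1.1 : ℕ) + 1 = x.1.1 :=
    hxy.imp (fun h1 => by rw [h1]) And.left
  have h2 : (x.1.1 : ℕ) = y.1.1 ∨ (x.1.1 : ℕ) + 1 = y.1.1 ∨ (y.1.1 : ℕ) + 1 = x.1.1 :=
    h1.imp_left fun h1 => by rw [h1]
  have hx := x.1.1.2
  have hy := y.1.1.2
  have key : ∃ i : Fin n, ∀ j : ℕ, j ≠ i → (x.1.1 : ℕ) ≠ 2 * j + 1 ∧ (y.1.1 : ℕ) ≠ 2 * j + 1 := by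
    rcases Nat.even_or_odd' (x.1.1 : ℕ) with ⟨a, ha | ha⟩
    · rcases Nat.even_or_odd' (y.1.1 : ℕ) with ⟨b, hb | hb⟩
      -- Both ends lie on odd-numbered levels, so no `g j` matters and any index serves.
      · exact ⟨⟨0, hn⟩, fun j _ => by omega⟩
      · exact ⟨⟨b, by omega⟩, fun j hj => by dsimp only at hj; omega⟩
    · exact ⟨⟨a, by omega⟩, fun j hj => by dsimp only at hj; omega⟩
  exact key.imp fun i hi j hj => hi j fun h1 => hj (Fin.ext h1)

variable (k : Type u) [Field k]

theorem bRep_Z (r : ℕ) (hrn : r < n) : bRep k n r (Z k n) = 0 := by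
  refine eq_zero_of_factors k hrn (fun i => Qmap k (actB (g i)))
    (span_fixed_eq_top k _ fun x y hxy => ?_) _ fun i => ?_
  · exact (exists_level_of_rel (by omega) hxy).imp fun i hi j hj =>
      ⟨actB_g_eq_iff j x (hi j hj).1, actB_g_eq_iff j y (hi j hj).2⟩
  · rw [Z_eq_mul k i, bRep_mul, map_sub, bRep_one, bRep_elt]
    exact ⟨_, rfl⟩

theorem cRep_Z (r : ℕ) (hrn : r < n) (s : SignTypeˣ) :
    cRep k n r s s ⟨Z k n, Z_mem k n s⟩ = 0 := by
  refine eq_zero_of_factors k hrn (fun i => Qmap k (actC ⟨g i, g_mem_Whom i s⟩))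
    (span_fixed_eq_top k _ ?_) _ fun i => ?_
  · rintro _ _ ⟨x, y, hxy, rfl, rfl⟩
    exact (exists_level_of_rel (by omega) hxy).imp fun i hi j hj =>
      ⟨actC_g_eq_iff s j x (hi j hj).1, actC_g_eq_iff s j y (hi j hj).2⟩
  · have h1 : (⟨Z k n, Z_mem k n s⟩ : KWhom k n s s) =
      ⟨(1 - elt k (g i)) * ∏ j ∈ Finset.univ.erase i, (1 - elt k (g j)),
        mul_mem_KWhom k (prod_mem_KWhom k _ s)
          (Submodule.sub_mem _ (one_mem_KWhom k s) (elt_mem k (g_mem_Whom i s)))⟩ :=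
      Subtype.ext (Z_eq_mul k i)
    refine ⟨cRep k n r s s ⟨_, prod_mem_KWhom k (Finset.univ.erase i) s⟩, ?_⟩
    rw [h1, cRep_mul k r ⟨_, prod_mem_KWhom k (Finset.univ.erase i) s⟩ ⟨1 - elt k (g i),
      Submodule.sub_mem _ (one_mem_KWhom k s) (elt_mem k (g_mem_Whom i s))⟩]
    congr 1
    rw [← cRep_one, ← cRep_elt, ← map_sub]
    rfl

/-- The composite is the image of T² = 1 - Z, and Z acts as 0. -/
theorem cRep_T_comp (r : ℕ) (hrn : r < n) (s t : SignTypeˣ) (hst : t = -s) (hts : s = -t) :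
    cRep k n r t s ⟨T k n, T_mem k n t s hts⟩ ≫ cRep k n r s t ⟨T k n, T_mem k n s t hst⟩ =
      𝟙 _ := by
  rw [← cRep_mul, ← cRep_one, ← sub_zero (cRep k n r s s ⟨1, _⟩), ← cRep_Z k r hrn s, ← map_sub]
  congr 1
  exact Subtype.ext ((sq _).symm.trans (T_sq k n))

end

/-! ## An invariant of algebras -/

section Invariant

variable (k : Type u) [Field k]
variable {A B : Type u} [NonUnitalCommRing A] [Module k A] [IsScalarTower k A A]
  [SMulCommClass k A A] [NonUnitalCommRing B] [Module k B] [IsScalarTower k B B]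
  [SMulCommClass k B B]

/-- The annihilator of an element. -/
def annih (a : A) : Submodule k A := LinearMap.ker (LinearMap.mul k A a)

theorem mem_annih {a b : A} : b ∈ annih k a ↔ a * b = 0 := Iff.rfl

/-- The annihilator of `a` has codimension 3. -/
def IsThin (a : A) : Prop := Module.finrank k (A ⧸ annih k a) = 3

variable (A) in
/-- A property of thin elements that is shared by any two of them with `Ann a + Ann b ≠ A` holds
for all of them or for none. -/
def ThinConnected : Prop :=
  ∀ c : A → Prop,
    (∀ a b, IsThin k a → IsThin k b → annih k a ⊔ annih k b ≠ ⊤ → (c a ↔ c b)) →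
    ∀ a b, IsThin k a → IsThin k b → (c a ↔ c b)

theorem map_annih (f : A →ₙₐ[k] B) (e : A ≃ₗ[k] B) (he : ∀ a, e a = f a) (a : A) :
    (annih k a).map (e : A →ₗ[k] B) = annih k (e a) := by
  ext b
  obtain ⟨b, rfl⟩ := e.surjective b
  rw [Submodule.mem_map_equiv, e.symm_apply_apply, mem_annih, mem_annih, he, he, ← map_mul, ← he,
    e.map_eq_zero_iff]

/-- The property involves only codimensions and sums of annihilators, which an isomorphism
preserves; a predicate on A is transported to B along the inverse. -/
theorem ThinConnected.of_bijective (f : A →ₙₐ[k] B) (hf : Function.Bijective f)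
    (hB : ThinConnected k B) : ThinConnected k A := by
  let e : A ≃ₗ[k] B := LinearEquiv.ofBijective (f : A →ₗ[k] B) hf
  have he : ∀ a, e a = f a := fun _ => rfl
  have h1 : ∀ a, IsThin k (e a) ↔ IsThin k a := fun a => by
    rw [IsThin, IsThin,
      (Submodule.Quotient.equiv (annih k a) (annih k (e a)) e (map_annih k f e he a)).finrank_eq]
  have h2 : ∀ a b, annih k (e a) ⊔ annih k (e b) = ⊤ ↔ annih k a ⊔ annih k b = ⊤ := fun a b => by
    rw [← map_annih k f e he, ← map_annih k f e he, ← Submodule.map_sup]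
    exact map_eq_top_iff (Submodule.orderIsoMapComap e)
  intro c hc a b ha hb
  have h3 := hB (fun b => c (e.symm b)) (fun x y hx hy hxy => by
    obtain ⟨x, rfl⟩ := e.surjective x
    obtain ⟨y, rfl⟩ := e.surjective y
    rw [e.symm_apply_apply, e.symm_apply_apply]
    exact hc x y ((h1 x).1 hx) ((h1 y).1 hy) (mt (h2 x y).2 hxy))
    (e a) (e b) ((h1 a).2 ha) ((h1 b).2 hb)
  rwa [e.symm_apply_apply, e.symm_apply_apply] at h3

end Invariant

/-! ### Annihilators in the algebra of a graph -/

section GraphInvariant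

variable (k : Type u) [Field k] {V : Type} {G : Graph V}

/-- The element of `Q(G)` with given components. -/
def Q.of (b : V → k) (c : Deg2 k G) : Q k G := (b, c)

/-- A vanishing product means that a(x)b(y) has the form u - σu, hence is zero on the diagonal and
antisymmetric off it. If a(x)b(y) ≠ 0, the diagonal (the graph is reflexive) gives b(x) = 0. Then
the value a(y)b(x) at (y, x) is 0, contradicting antisymmetry. No assumption on the characteristic
is needed. -/
theorem Q.mul_eq_zero_iff (a b : Q k G) :
    a * b = 0 ↔ ∀ x y, G.Rel x y → a.1 x = 0 ∨ b.1 y = 0 := by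
  constructor
  · intro hab
    have h1 : mulDeg1 k G a.1 b.1 = 0 := congrArg Prod.snd hab
    obtain ⟨u, hu⟩ := (Submodule.Quotient.mk_eq_zero _).1 h1
    have h2 : ∀ x y (hxy : G.Rel x y),
        u ⟨(x, y), hxy⟩ - u ⟨(y, x), G.symm _ _ hxy⟩ = a.1 x * b.1 y :=
      fun x y hxy => congrFun hu ⟨(x, y), hxy⟩
    have h3 : ∀ x, a.1 x * b.1 x = 0 := fun x => by rw [← h2 x x (G.refl x), sub_self]
    intro x y hxy
    by_contra! hne
    have h4 : b.1 x = 0 := (mul_eq_zero.1 (h3 x)).resolve_left hne.1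
    have h5 := h2 x y hxy
    have h6 := h2 y x (G.symm _ _ hxy)
    rw [h4, mul_zero] at h6
    rw [← neg_sub, h6, neg_zero] at h5
    exact mul_ne_zero hne.1 hne.2 h5.symm
  · intro hab
    refine Prod.ext rfl ?_
    change (swapDiff k G).mkQ (fun e => a.1 e.1.1 * b.1 e.1.2) = 0
    have : (fun e : G.Two => a.1 e.1.1 * b.1 e.1.2) = 0 :=
      funext fun e => mul_eq_zero.2 (hab _ _ e.2)
    rw [this, map_zero]

/-- The closed neighbourhood of the support of the degree-1 component. -/
def nbhd (a : Q k G) : Set V := {y | ∃ x, G.Rel x y ∧ a.1 x ≠ 0}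

theorem Q.mem_annih {a b : Q k G} : b ∈ annih k a ↔ ∀ y ∈ nbhd k a, b.1 y = 0 := by
  refine (Q.mul_eq_zero_iff k a b).trans ⟨?_, fun hb x y hxy => ?_⟩
  · rintro hb y ⟨x, hxy, hx⟩
    exact (hb x y hxy).resolve_left hx
  · by_contra! hne
    exact hne.2 (hb y ⟨x, hxy, hne.1⟩)

/-- The annihilator is the kernel of restriction to the neighbourhood, which is onto; degree 2 lies
wholly in this kernel. -/
theorem finrank_quotient_annih [Finite V] (a : Q k G) :
    Module.finrank k (Q k G ⧸ annih k a) = (nbhd k a).ncard := by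
  classical
  let _ := Fintype.ofFinite (nbhd k a)
  let ρ : Q k G →ₗ[k] (nbhd k a → k) :=
    LinearMap.funLeft k k Subtype.val ∘ₗ LinearMap.fst k (V → k) (Deg2 k G)
  have hρ : ∀ b y, ρ b y = b.1 y.1 := fun _ _ => rfl
  have h1 : Function.Surjective ρ := fun u =>
    ⟨Q.of k (fun y => if hy : y ∈ nbhd k a then u ⟨y, hy⟩ else 0) 0, funext fun y => by
      rw [hρ]
      exact dif_pos y.2⟩
  have h2 : annih k a = LinearMap.ker ρ := by
    ext b
    rw [Q.mem_annih, LinearMap.mem_ker, funext_iff, Subtype.forall]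
    rfl
  rw [h2, (ρ.quotKerEquivOfSurjective h1).finrank_eq, Module.finrank_fintype_fun_eq_card,
    ← Nat.card_eq_fintype_card, Nat.card_coe_set_eq]

/-- If the neighbourhoods are disjoint, any element splits into a part vanishing on the first and a
part supported there, hence vanishing on the second. At a common vertex every element of the sum
vanishes, whereas the constant function 1 does not. -/
theorem annih_sup_ne_top_iff (a b : Q k G) :
    annih k a ⊔ annih k b ≠ ⊤ ↔ (nbhd k a ∩ nbhd k b).Nonempty := by
  classical
  constructor
  · contrapose!
    intro hab
    refine eq_top_iff.2 fun d _ => Submodule.mem_sup.2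
      ⟨Q.of k (fun y => if y ∈ nbhd k a then 0 else d.1 y) d.2, ?_,
        Q.of k (fun y => if y ∈ nbhd k a then d.1 y else 0) 0, ?_, Prod.ext ?_ ?_⟩
    · rw [Q.mem_annih]
      exact fun y hy => if_pos hy
    · rw [Q.mem_annih]
      exact fun y hy => if_neg fun hy' => Set.eq_empty_iff_forall_notMem.1 hab y ⟨hy', hy⟩
    · funext y
      change (if y ∈ nbhd k a then 0 else d.1 y) + (if y ∈ nbhd k a then d.1 y else 0) = d.1 y
      split_ifs <;> simp
    · exact add_zero _
  · rintro ⟨y, hya, hyb⟩ htop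
    have h1 : Q.of k (fun _ => 1) 0 ∈ annih k a ⊔ annih k b :=
      htop ▸ Submodule.mem_top
    obtain ⟨d, hd, d', hd', hdd⟩ := Submodule.mem_sup.1 h1
    have h2 : d.1 y + d'.1 y = 1 := congrFun (congrArg Prod.fst hdd) y
    rw [(Q.mem_annih k).1 hd y hya, (Q.mem_annih k).1 hd' y hyb, add_zero] at h2
    exact zero_ne_one h2

end GraphInvariant

/-! ## Neighbourhoods in the crowns -/

section Crown

variable {n : ℕ} (s : SignTypeˣ)

/-- The vertex of the crown on the level numbered `2i + 1`, `0 ≤ i ≤ n`. -/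
def odd (i : Fin (n + 1)) (u : SignTypeˣ) : Quot (glue n s) :=
  Quot.mk _ ⟨(⟨2 * i, by omega⟩, u), fun _ => u.ne_zero⟩

/-- The vertex of the crown on the level numbered `2i + 2`, `0 ≤ i < n`. -/
def even (i : Fin n) (v : SignType) : Quot (glue n s) :=
  Quot.mk _ ⟨(⟨2 * i + 1, by omega⟩, v), fun h1 => absurd h1 (by simp)⟩

theorem units_mul_self_ne (u : SignTypeˣ) : (u : SignType) * u ≠ -1 := by
  have : ∀ a : SignType, a * a ≠ -1 := by decide
  exact this _

theorem exists_odd_or_even (hn : 2 ≤ n) (x : Quot (glue n s)) :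
    (∃ (i : Fin n) (u : SignTypeˣ), x = odd s i.castSucc u) ∨
      ∃ (i : Fin n) (v : SignType), x = even s i v := by
  induction x using Quot.ind with | mk x
  obtain ⟨⟨⟨l, hl⟩, v⟩, hx⟩ := x
  rcases Nat.even_or_odd' l with ⟨i, rfl | rfl⟩
  · have hv : v ≠ 0 := hx (by simp)
    by_cases hi : i < n
    · exact Or.inl ⟨⟨i, hi⟩, Units.mk0 v hv, rfl⟩
    · obtain rfl : i = n := by omega
      refine Or.inl ⟨⟨0, by omega⟩, s * Units.mk0 v hv, Quot.sound ⟨rfl, rfl, rfl⟩⟩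
  · exact Or.inr ⟨⟨i, by omega⟩, v, rfl⟩

/-- The seam of the crown: here the sign s separates the two cases. -/
theorem odd_last (u : SignTypeˣ) : odd s (Fin.last n) u = odd s 0 (s * u) :=
  Quot.sound ⟨rfl, rfl, Units.val_mul s u⟩

theorem rel_odd_castSucc_even (i : Fin n) (u : SignTypeˣ) (v : SignType)
    (huv : (u : SignType) * v ≠ -1) : (C n s).Rel (odd s i.castSucc u) (even s i v) :=
  ⟨_, _, Or.inr ⟨Or.inl rfl, huv⟩, rfl, rfl⟩

theorem rel_odd_succ_even (i : Fin n) (u : SignTypeˣ) (v : SignType)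
    (huv : (u : SignType) * v ≠ -1) : (C n s).Rel (odd s i.succ u) (even s i v) :=
  ⟨_, _, Or.inr ⟨Or.inr rfl, huv⟩, rfl, rfl⟩

/-- Level and sign of a vertex of the crown, those on the last level being read on the first. -/
def code (hn : 2 ≤ n) : Quot (glue n s) → ℕ × SignType :=
  Quot.lift (fun x => if (x.1.1 : ℕ) = 2 * n then (0, s * x.1.2) else (x.1.1, x.1.2)) (by
    rintro x y ⟨hx, hy, hxy⟩
    have h1 : ¬ 0 = 2 * n := by omega
    simp only [hx, hy, Fin.val_last, Fin.val_zero, if_true, hxy, if_neg h1])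

theorem code_even (hn : 2 ≤ n) (i : Fin n) (v : SignType) : code s hn (even s i v) = (2 * (i : ℕ) + 1, v) :=
  if_neg (by dsimp only; omega)

theorem code_odd_castSucc (hn : 2 ≤ n) (i : Fin n) (u : SignTypeˣ) :
    code s hn (odd s i.castSucc u) = (2 * (i : ℕ), (u : SignType)) :=
  if_neg (by simp only [Fin.val_castSucc]; omega)

theorem code_odd_succ (hn : 2 ≤ n) (i : Fin n) (u : SignTypeˣ) :
    code s hn (odd s i.succ u) =
      if (i : ℕ) + 1 = n then (0, (s : SignType) * u) else (2 * (i : ℕ) + 2, (u : SignType)) := by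
  by_cases hi : (i : ℕ) + 1 = n
  · rw [if_pos hi]
    exact if_pos (by simp only [Fin.val_succ]; omega)
  · rw [if_neg hi]
    exact if_neg (by simp only [Fin.val_succ]; omega)

/-- The closed neighbourhood of a vertex on an even-numbered level with nonzero sign. -/
theorem rel_even_iff (hn : 2 ≤ n) (i : Fin n) (u : SignTypeˣ) (y : Quot (glue n s)) :
    (C n s).Rel (even s i u) y ↔
      y = odd s i.castSucc u ∨ y = even s i u ∨ y = odd s i.succ u := by
  have hu := units_mul_self_ne u
  constructor
  · rintro ⟨x', y, hxy, hx', rfl⟩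
    have h1 : code s hn (Quot.mk _ x') = (2 * (i : ℕ) + 1, (u : SignType)) := by
      rw [hx', code_even]
    have h2 : ((x'.1.1 : ℕ), x'.1.2) = (2 * (i : ℕ) + 1, (u : SignType)) := by
      change (if (x'.1.1 : ℕ) = 2 * n then (0, s * x'.1.2) else ((x'.1.1 : ℕ), x'.1.2)) = _ at h1
      split_ifs at h1 with h3
      · simp at h1
      · exact h1
    obtain ⟨h3, h4⟩ := Prod.ext_iff.1 h2
    dsimp only at h3 h4
    rcases hxy with rfl | ⟨hl, hv⟩
    · exact Or.inr (Or.inl hx')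
    · rw [h4] at hv
      rw [h3] at hl
      obtain ⟨⟨⟨l, hlt⟩, v⟩, hy⟩ := y
      dsimp only at hl hv
      have hlv : (2 * (i : ℕ) + 1 + 1 = l ∨ l = 2 * (i : ℕ)) := by omega
      have hv0 : v ≠ 0 := hy (by
        rcases hlv with rfl | rfl
        · exact ⟨i + 1, by dsimp only; omega⟩
        · exact ⟨i, by dsimp only; omega⟩)
      have huv : v = u := by
        have : ∀ a b : SignType, a ≠ 0 → b ≠ 0 → a * b ≠ -1 → b = a := by decide
        exact this _ _ u.ne_zero hv0 hv
      subst huv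
      rcases hlv with rfl | rfl
      · exact Or.inr (Or.inr rfl)
      · exact Or.inl rfl
  · rintro (rfl | rfl | rfl)
    · exact (C n s).symm _ _ (rel_odd_castSucc_even s i u u hu)
    · exact (C n s).refl _
    · exact (C n s).symm _ _ (rel_odd_succ_even s i u u hu)

/-- An odd-level vertex borders two even-numbered levels, and these are different because n ≥ 2.
This provides enough neighbours to show that such a vertex is not thin. -/
theorem exists_odd_succ (hn : 2 ≤ n) (i : Fin n) (u : SignTypeˣ) :
    ∃ (j : Fin n) (v : SignTypeˣ), j ≠ i ∧ odd s i.castSucc u = odd s j.succ v := by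
  have hsu : s * (s * u) = u := by revert s u; decide
  obtain ⟨n, rfl⟩ : ∃ m, n = m + 1 := ⟨n - 1, by omega⟩
  induction i using Fin.cases with
  | zero =>
    refine ⟨Fin.last n, s * u, fun h1 => ?_, ?_⟩
    · have := congrArg Fin.val h1
      simp only [Fin.val_last, Fin.val_zero] at this
      omega
    · rw [Fin.succ_last, odd_last, hsu]
      rfl
  | succ i =>
    exact ⟨i.castSucc, u, i.castSucc_lt_succ.ne, rfl⟩

theorem ncard_ne_three {V : Type} [Finite V] {S : Set V} {a b c d : V} (ha : a ∈ S) (hb : b ∈ S)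
    (hc : c ∈ S) (hd : d ∈ S) (hab : a ≠ b) (hac : a ≠ c) (had : a ≠ d) (hbc : b ≠ c)
    (hbd : b ≠ d) (hcd : c ≠ d) : S.ncard ≠ 3 := by
  classical
  have h1 : (({a, b, c, d} : Finset V) : Set V) ⊆ S := by
    intro x hx
    simp only [Finset.coe_insert, Finset.coe_singleton, Set.mem_insert_iff,
      Set.mem_singleton_iff] at hx
    rcases hx with rfl | rfl | rfl | rfl <;> assumption
  have h2 := Set.ncard_le_ncard h1 (Set.toFinite S)
  rw [Set.ncard_coe_finset] at h2
  have h3 : ({a, b, c, d} : Finset V).card = 4 := by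
    simp [hab, hac, had, hbc, hbd, hcd]
  omega

instance : Finite (Quot (glue n s)) := Finite.of_surjective _ Quot.mk_surjective

/-! ### Thin elements of the algebras of the crowns -/

variable (k : Type u) [Field k]

/-- The thin elements of the algebra of a crown are those supported in degree 1 at a vertex on an
even-numbered level with nonzero sign. -/
theorem isThin_iff (hn : 2 ≤ n) (a : Q k (C n s)) :
    IsThin k a ↔ ∃ (i : Fin n) (u : SignTypeˣ), ∀ x, a.1 x ≠ 0 ↔ x = even s i u := by
  have hdistinct : ∀ {x y : Quot (glue n s)}, code s hn x ≠ code s hn y → x ≠ y :=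
    fun hxy h1 => hxy (congrArg _ h1)
  rw [IsThin, finrank_quotient_annih]
  constructor
  · intro hcard
    have hmem : ∀ {x y}, a.1 x ≠ 0 → (C n s).Rel x y → y ∈ nbhd k a := fun hx hxy => ⟨_, hxy, hx⟩
    have key : ∀ x, a.1 x ≠ 0 → ∃ (i : Fin n) (u : SignTypeˣ), x = even s i u := by
      intro x hx
      rcases exists_odd_or_even s hn x with ⟨i, u, rfl⟩ | ⟨i, v, rfl⟩
      -- An odd-level vertex has at least four points in its neighbourhood: itself, the vertices of
      -- signs u and 0 on one side, and the vertex of sign 0 on the other.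
      · obtain ⟨j, v, hji, hj⟩ := exists_odd_succ s hn i u
        have hji' : (j : ℕ) ≠ i := fun h1 => hji (Fin.ext h1)
        refine absurd hcard (ncard_ne_three (hmem hx ((C n s).refl _))
          (hmem hx (rel_odd_castSucc_even s i u u (units_mul_self_ne u)))
          (hmem hx (rel_odd_castSucc_even s i u 0 (by simp)))
          (hmem hx (hj ▸ rel_odd_succ_even s j v 0 (by simp)))
          (hdistinct ?_) (hdistinct ?_) (hdistinct ?_) (hdistinct ?_) (hdistinct ?_) (hdistinct ?_))
        all_goals
          simp only [code_even, code_odd_castSucc, ne_eq, Prod.mk.injEq, u.ne_zero, and_false,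
            not_false_eq_true]
        all_goals omega
      -- A vertex of sign 0 is adjacent to both signs on each side, which again gives more than
      -- three points.
      · by_cases hv : v = 0
        · subst hv
          have h1 := i.2
          refine absurd hcard (ncard_ne_three (hmem hx ((C n s).refl _))
            (hmem hx ((C n s).symm _ _ (rel_odd_castSucc_even s i 1 0 (by simp))))
            (hmem hx ((C n s).symm _ _ (rel_odd_castSucc_even s i (-1) 0 (by simp))))
            (hmem hx ((C n s).symm _ _ (rel_odd_succ_even s i 1 0 (by simp))))
            (hdistinct ?_) (hdistinct ?_) (hdistinct ?_) (hdistinct ?_) (hdistinct ?_) (hdistinct ?_))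
          all_goals
            simp only [code_even, code_odd_castSucc, code_odd_succ]
            try split_ifs
          all_goals simp only [ne_eq, Prod.mk.injEq]
          all_goals first | omega | simp
        · exact ⟨i, Units.mk0 v hv, rfl⟩
    obtain ⟨-, x, -, hx⟩ : (nbhd k a).Nonempty := by
      by_contra! hempty
      rw [hempty, Set.ncard_empty] at hcard
      exact absurd hcard (by decide)
    obtain ⟨i, u, rfl⟩ := key x hx
    refine ⟨i, u, fun y => ⟨fun hy => ?_, fun hy => hy ▸ hx⟩⟩
    obtain ⟨j, v, rfl⟩ := key y hy
    by_contra hne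
    have hself := units_mul_self_ne u
    have h1 := i.2
    -- Two distinct vertices in the support, together with the two odd-level neighbours of the
    -- first, already make four points.
    refine absurd hcard (ncard_ne_three (hmem hx ((C n s).refl _)) (hmem hy ((C n s).refl _))
      (hmem hx ((C n s).symm _ _ (rel_odd_castSucc_even s i u u hself)))
      (hmem hx ((C n s).symm _ _ (rel_odd_succ_even s i u u hself)))
      (Ne.symm hne) (hdistinct ?_) (hdistinct ?_) (hdistinct ?_) (hdistinct ?_) (hdistinct ?_))
    all_goals
      simp only [code_even, code_odd_castSucc, code_odd_succ]
      try split_ifs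
    all_goals simp only [ne_eq, Prod.mk.injEq]
    all_goals omega
  · rintro ⟨i, u, hiu⟩
    have h1 : nbhd k a = {odd s i.castSucc u, even s i u, odd s i.succ u} := by
      ext y
      simp only [nbhd, Set.mem_ofPred_eq, hiu, exists_eq_right, Set.mem_insert_iff,
        Set.mem_singleton_iff, rel_even_iff s hn]
    rw [h1, Set.ncard_eq_three]
    refine ⟨_, _, _, hdistinct ?_, hdistinct ?_, hdistinct ?_, rfl⟩
    all_goals
      simp only [code_even, code_odd_castSucc, code_odd_succ]
      try split_ifs
    all_goals simp only [ne_eq, Prod.mk.injEq]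
    all_goals omega

theorem nbhd_inter_nonempty (hn : 2 ≤ n) {a b : Q k (C n s)} {i j : Fin n} {u v : SignTypeˣ}
    (ha : ∀ x, a.1 x ≠ 0 ↔ x = even s i u) (hb : ∀ x, b.1 x ≠ 0 ↔ x = even s j v)
    {y : Quot (glue n s)} (hy : y = odd s i.castSucc u ∨ y = even s i u ∨ y = odd s i.succ u)
    (hy' : y = odd s j.castSucc v ∨ y = even s j v ∨ y = odd s j.succ v) :
    annih k a ⊔ annih k b ≠ ⊤ :=
  (annih_sup_ne_top_iff k a b).2 ⟨y, ⟨_, (rel_even_iff s hn i u y).2 hy, (ha _).2 rfl⟩,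
    ⟨_, (rel_even_iff s hn j v y).2 hy', (hb _).2 rfl⟩⟩

/-- The indicator function of a vertex on an even-numbered level. -/
def evenElt (i : Fin n) (u : SignTypeˣ) : Q k (C n s) := by
  classical exact Q.of k (Pi.single (even s i u) 1) 0

theorem evenElt_ne_zero_iff (i : Fin n) (u : SignTypeˣ) (x : Quot (glue n s)) :
    (evenElt s k i u).1 x ≠ 0 ↔ x = even s i u := by
  classical
  change Pi.single (M := fun _ => k) (even s i u) 1 x ≠ 0 ↔ _
  rw [Pi.single_apply]
  split_ifs with h1 <;> simp [h1]

theorem isThin_evenElt (hn : 2 ≤ n) (i : Fin n) (u : SignTypeˣ) : IsThin k (evenElt s k i u) :=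
  (isThin_iff s k hn _).2 ⟨i, u, evenElt_ne_zero_iff s k i u⟩

theorem thinConnected_mobius (hn : 2 ≤ n) : ThinConnected k (Q k (C n (-1))) := by
  intro c hc
  have h1 : ∀ (i j : Fin n) (u v : SignTypeˣ) (y : Quot (glue n (-1))),
      (y = odd (-1) i.castSucc u ∨ y = even (-1) i u ∨ y = odd (-1) i.succ u) →
      (y = odd (-1) j.castSucc v ∨ y = even (-1) j v ∨ y = odd (-1) j.succ v) →
      (c (evenElt (-1) k i u) ↔ c (evenElt (-1) k j v)) := fun i j u v y hy hy' =>
    hc _ _ (isThin_evenElt _ k hn i u) (isThin_evenElt _ k hn j v)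
      (nbhd_inter_nonempty _ k hn (evenElt_ne_zero_iff _ k i u) (evenElt_ne_zero_iff _ k j v) hy hy')
  obtain ⟨n, rfl⟩ : ∃ m, n = m + 1 := ⟨n - 1, by omega⟩
  have h2 : ∀ (i : Fin (n + 1)) (u : SignTypeˣ),
      c (evenElt (-1) k i u) ↔ c (evenElt (-1) k 0 u) := by
    intro i u
    induction i using Fin.induction with
    | zero => rfl
    | succ i ih =>
      exact (h1 _ _ u u (odd (-1) i.succ.castSucc u) (Or.inl rfl) (Or.inr (Or.inr rfl))).trans ih
  -- Crossing the seam: the last vertex of the strand of sign -1 meets the first vertex of the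
  -- strand of sign 1, since (-1)(-1) = 1.
  have h3 : c (evenElt (-1) k 0 (-1)) ↔ c (evenElt (-1) k 0 1) := by
    rw [← h2 (Fin.last n) (-1)]
    refine h1 _ _ _ _ (odd (-1) (Fin.last n).succ (-1)) (Or.inr (Or.inr rfl)) (Or.inl ?_)
    rw [Fin.succ_last, odd_last, neg_mul_neg, one_mul]
    rfl
  have h4 : ∀ u : SignTypeˣ, u = 1 ∨ u = -1 := by decide
  -- A thin element has the same degree-1 support as some `evenElt`, so their neighbourhoods meet.
  have h5 : ∀ a, IsThin k a → (c a ↔ c (evenElt (-1) k 0 1)) := by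
    intro a ha
    obtain ⟨i, u, hiu⟩ := (isThin_iff _ k hn a).1 ha
    refine (hc a _ ha (isThin_evenElt _ k hn i u) (nbhd_inter_nonempty _ k hn hiu
      (evenElt_ne_zero_iff _ k i u) (Or.inl rfl) (Or.inl rfl))).trans ((h2 i u).trans ?_)
    rcases h4 u with rfl | rfl
    · rfl
    · exact h3
  exact fun a b ha hb => (h5 a ha).trans (h5 b hb).symm

theorem not_thinConnected_simple (hn : 2 ≤ n) : ¬ ThinConnected k (Q k (C n 1)) := by
  intro H
  -- For s = 1 the gluing preserves signs, so the sign is constant on the neighbourhood of a thin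
  -- vertex. Having sign 1 is then shared by linked thin elements, but not by all of them.
  have hsgn : ∀ (i : Fin n) (u : SignTypeˣ) (y : Quot (glue n 1)), (C n 1).Rel (even 1 i u) y →
      (code 1 hn y).2 = u := by
    intro i u y hy
    rcases (rel_even_iff 1 hn i u y).1 hy with rfl | rfl | rfl
    · rw [code_odd_castSucc]
    · rw [code_even]
    · rw [code_odd_succ]
      split_ifs
      · exact one_mul _
      · rfl
  have hc : ∀ (a : Q k (C n 1)) (i : Fin n) (u : SignTypeˣ), (∀ x, a.1 x ≠ 0 ↔ x = even 1 i u) →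
      ((∃ x, (code 1 hn x).2 = 1 ∧ a.1 x ≠ 0) ↔ (u : SignType) = 1) := by
    intro a i u hiu
    simp only [hiu, exists_eq_right, code_even]
  have h1 := H (fun a => ∃ x, (code 1 hn x).2 = 1 ∧ a.1 x ≠ 0) (fun a b ha hb hab => by
      obtain ⟨i, u, hiu⟩ := (isThin_iff _ k hn a).1 ha
      obtain ⟨j, v, hjv⟩ := (isThin_iff _ k hn b).1 hb
      obtain ⟨y, ⟨x, hxy, hx⟩, ⟨x', hxy', hx'⟩⟩ := (annih_sup_ne_top_iff k a b).1 hab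
      rw [(hiu x).1 hx] at hxy
      rw [(hjv x').1 hx'] at hxy'
      rw [hc a i u hiu, hc b j v hjv, ← hsgn i u y hxy, hsgn j v y hxy'])
    _ _ (isThin_evenElt 1 k hn ⟨0, by omega⟩ 1) (isThin_evenElt 1 k hn ⟨0, by omega⟩ (-1))
  rw [hc _ _ _ (evenElt_ne_zero_iff 1 k _ _), hc _ _ _ (evenElt_ne_zero_iff 1 k _ _)] at h1
  exact absurd (h1.1 rfl) (by decide)

instance : Module.Finite k (Q k (C n s)) :=
  inferInstanceAs (Module.Finite k ((Quot (glue n s) → k) × Deg2 k (C n s)))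

end Crown

end MobiusCrown

end

/-! ### The main theorem -/

open MobiusCrown in
theorem mainTheorem1 (k : Type*) [Field k] (r : ℕ) (hr : 1 ≤ r) :
    Module.Finite k (Q k (C (r + 1) 1)) ∧
    Module.Finite k (Q k (C (r + 1) (-1))) ∧
    (¬ ∃ f : Q k (C (r + 1) 1) →ₙₐ[k] Q k (C (r + 1) (-1)), Function.Bijective f) ∧
    T k (r + 1) ^ 2 = 1 - Z k (r + 1) ∧
    bRep k (r + 1) r (Z k (r + 1)) = 0 ∧
    (∀ s : SignTypeˣ, cRep k (r + 1) r s s ⟨Z k (r + 1), Z_mem k (r + 1) s⟩ = 0) ∧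
    ∃ α : loday k (Q k (C (r + 1) 1)) r ≅ loday k (Q k (C (r + 1) (-1))) r,
      α.hom = cRep k (r + 1) r (-1) 1 ⟨T k (r + 1), T_mem k (r + 1) (-1) 1 (neg_neg 1).symm⟩ ∧
      α.inv = cRep k (r + 1) r 1 (-1) ⟨T k (r + 1), T_mem k (r + 1) 1 (-1) rfl⟩ := by
  refine ⟨inferInstance, inferInstance, ?_, T_sq k _, bRep_Z k r r.lt_succ_self,
    cRep_Z k r r.lt_succ_self, ⟨_, _, cRep_T_comp k r r.lt_succ_self 1 (-1) rfl (neg_neg 1).symm,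
      cRep_T_comp k r r.lt_succ_self (-1) 1 (neg_neg 1).symm rfl⟩, rfl, rfl⟩
  rintro ⟨f, hf⟩
  -- The assumption r ≥ 1 is needed here: the analysis of neighbourhoods in the crowns requires n ≥
  -- 2.
  have hn : 2 ≤ r + 1 := by omega
  exact not_thinConnected_simple k hn ((thinConnected_mobius k hn).of_bijective k f hf)
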